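/- Let $\mathcal{A}$ be a von Neumann algebra acting on a complex Hilbert space, equipped with a faithful normal finite trace $\tau$, that is, a positive ultraweakly continuous linear functional $\tau:\mathcal{A}\to\mathbb{C}$ with $\tau(xy)=\tau(yx)$ for all $x,y\in\mathcal{A}$ and $\tau(x^*x)=0$ only for $x=0$ (so $\mathcal{A}$ is a finite von Neumann algebra). Let $L^2(\tau)$ be the Hilbert space completion of $\mathcal{A}$ for the inner product $\langle x,y\rangle=\tau(x^*y)$, and let $\pi:\mathcal{A}\to\mathcal{B}(L^2(\tau))$, $\pi(x)=L_x$, be the left regular representation, determined by $L_x(y)=xy$ for $y\in\mathcal{A}$. Let $\mathcal{M}\subseteq\mathcal{A}$ be a (not necessarily self-adjoint or closed) subalgebra that has factorization in $\mathcal{A}$: for every positive invertible $D\in\mathcal{A}$ there is an invertible $S\in\mathcal{A}$ with $S,S^{-1}\in\mathcal{M}$ and $D=S^*S$. Let $H^2=[\mathcal{M}]$ be the closure of $\mathcal{M}$ in $L^2(\tau)$, and define $\phi:\mathcal{A}\to\mathcal{B}(H^2)$ by $$\phi(x)=P_{H^2}L_x|_{H^2},\qquad x\in\mathcal{A},$$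 where $P_{H^2}$ is the orthogonal projection onto $H^2$. Then $\phi$ is a $C^*$-extreme point of the set $S_{H^2}(\mathcal{A})$ of all unital completely positive maps $\mathcal{A}\to\mathcal{B}(H^2)$. That is, $\phi\in S_{H^2}(\mathcal{A})$, and whenever $\phi(a)=\sum_{i=1}^n T_i^*\phi_i(a)T_i$ for all $a\in\mathcal{A}$, with $\phi_i\in S_{H^2}(\mathcal{A})$ and invertible $T_i\in\mathcal{B}(H^2)$ such that $\sum_{i=1}^n T_i^*T_i=I_{H^2}$, then for each $i$ there is a unitary $U_i\in\mathcal{B}(H^2)$ with $\phi_i(a)=U_i^*\phi(a)U_i$ for all $a\in\mathcal{A}$. -/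

import Mathlib

open scoped ComplexOrder InnerProductSpace CStarAlgebra Topology

noncomputable section

universe u v

/-! ### A von Neumann algebra as an ordered C⋆-algebra -/

namespace VonNeumannAlgebra

variable {K : Type u} [NormedAddCommGroup K] [InnerProductSpace ℂ K] [CompleteSpace K]

instance instSMulMemClass : SMulMemClass (VonNeumannAlgebra K) ℂ (K →L[ℂ] K) where
  smul_mem {s} r _ hx := s.toStarSubalgebra.toSubalgebra.smul_mem hx r

instance instIsClosed (A : VonNeumannAlgebra K) : IsClosed (A : Set (K →L[ℂ] K)) := by
  rw [← A.centralizer_centralizer]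
  exact Set.isClosed_centralizer _

/-- The C⋆-algebra structure that `A` inherits from the bounded operators on `K`. -/
instance instCStarAlgebra (A : VonNeumannAlgebra K) : CStarAlgebra A :=
  StarSubalgebra.cstarAlgebra A

/-- The order that `A` inherits from the bounded operators on `K` (the order on the subtype, in
which `x ≤ y` means that the operator `y - x` is positive) is the order of the C⋆-algebra `A`. -/
instance instStarOrderedRing (A : VonNeumannAlgebra K) : StarOrderedRing A := by
  refine StarOrderedRing.of_nonneg_iff' (fun {x y} h z => ?_) (fun x => ⟨fun hx => ?_, ?_⟩)
  · exact add_le_add_right (α := K →L[ℂ] K) h (z : K →L[ℂ] K)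
  · have hx' : (0 : K →L[ℂ] K) ≤ (x : K →L[ℂ] K) := hx
    have hmem : CFC.sqrt (x : K →L[ℂ] K) ∈ A := by
      rw [← SetLike.mem_coe, ← A.centralizer_centralizer]
      intro m hm
      have hc : Commute (x : K →L[ℂ] K) m := hm x x.2
      exact (hc.cfcₙ_nnreal NNReal.sqrt).eq.symm
    refine ⟨⟨CFC.sqrt (x : K →L[ℂ] K), hmem⟩, Subtype.ext ?_⟩
    change (x : K →L[ℂ] K) = star (CFC.sqrt (x : K →L[ℂ] K)) * CFC.sqrt (x : K →L[ℂ] K)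
    rw [(CFC.sqrt_nonneg (x : K →L[ℂ] K)).isSelfAdjoint.star_eq, CFC.sqrt_mul_sqrt_self _ hx']
  · rintro ⟨s, rfl⟩
    exact star_mul_self_nonneg (s : K →L[ℂ] K)

/-- The ultraweak (that is, σ-weak) topology on a von Neumann algebra `A` on `K`: the coarsest
topology making all functionals `x ↦ ∑ₙ ⟪ξₙ, x ηₙ⟫` continuous, where `(ξₙ)` and `(ηₙ)` are
sequences of vectors with `∑ₙ ‖ξₙ‖² < ∞` and `∑ₙ ‖ηₙ‖² < ∞`. -/
abbrev ultraweakTopology (A : VonNeumannAlgebra K) : TopologicalSpace A :=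
  ⨅ (ξ : ℕ → K) (η : ℕ → K) (_ : Summable fun n => ‖ξ n‖ ^ 2) (_ : Summable fun n => ‖η n‖ ^ 2),
    TopologicalSpace.induced (fun x : A => ∑' n, ⟪ξ n, (x : K →L[ℂ] K) (η n)⟫_ℂ) inferInstance

/-- A faithful normal finite trace on the von Neumann algebra `A`. -/
structure IsFaithfulNormalTrace (A : VonNeumannAlgebra K) (τ : A →ₚ[ℂ] ℂ) : Prop where
  map_mul_comm : ∀ x y : A, τ (x * y) = τ (y * x)
  faithful : ∀ x : A, τ (star x * x) = 0 → x = 0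
  normal : Continuous[A.ultraweakTopology, inferInstance] τ

end VonNeumannAlgebra

/-! ### Generalized state spaces and C⋆-extreme points -/

section CStarConvexity

variable {A : Type u} [CStarAlgebra A] [PartialOrder A] [StarOrderedRing A]
  {H : Type v} [NormedAddCommGroup H] [InnerProductSpace ℂ H] [CompleteSpace H]

variable (A H) in
/-- The generalized state space `S_H(A)`: all unital completely positive maps `A → B(H)`. -/
def generalizedStateSpace : Set (A →ₗ[ℂ] (H →L[ℂ] H)) :=
  {φ | φ 1 = 1 ∧ ∃ ψ : A →CP (H →L[ℂ] H), ψ.toLinearMap = φ}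

/-- `φ` is a C⋆-extreme point of `S_H(A)`: it belongs to `S_H(A)`, and whenever
`φ(·) = ∑ᵢ Tᵢ⋆ φᵢ(·) Tᵢ` with `φᵢ ∈ S_H(A)`, `Tᵢ` invertible and `∑ᵢ Tᵢ⋆ Tᵢ = 1`, each `φᵢ` is
unitarily equivalent to `φ`. -/
def IsCStarExtreme (φ : A →ₗ[ℂ] (H →L[ℂ] H)) : Prop :=
  φ ∈ generalizedStateSpace A H ∧
    ∀ (n : ℕ) (T : Fin n → (H →L[ℂ] H)) (φs : Fin n → (A →ₗ[ℂ] (H →L[ℂ] H))),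
      (∀ i, φs i ∈ generalizedStateSpace A H) →
      (∀ i, IsUnit (T i)) →
      ∑ i, star (T i) * T i = 1 →
      (∀ a, φ a = ∑ i, star (T i) * φs i a * T i) →
      ∀ i, ∃ U ∈ unitary (H →L[ℂ] H), ∀ a, φs i a = star U * φ a * U

/-- A (not necessarily closed, self-adjoint or unital) subalgebra `M` of a C⋆-algebra `A` has
factorization in `A` if every positive invertible `d ∈ A` is of the form `s⋆ s` with `s` invertible
in `A` and `s, s⁻¹ ∈ M`. -/
def HasFactorization (M : NonUnitalSubalgebra ℂ A) : Prop :=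
  ∀ d : A, 0 ≤ d → IsUnit d → ∃ s : Aˣ, (s : A) ∈ M ∧ ((s⁻¹ : Aˣ) : A) ∈ M ∧ d = star (s : A) * s

/-- The compression `a ↦ P_E π(a)|_E` of a representation `π` to a closed subspace `E`. -/
def compression {L : Type v} [NormedAddCommGroup L] [InnerProductSpace ℂ L] [CompleteSpace L]
    (π : A →⋆ₐ[ℂ] (L →L[ℂ] L)) (E : Submodule ℂ L) [CompleteSpace E] : A →ₗ[ℂ] (E →L[ℂ] E) where
  toFun a := E.orthogonalProjectionOnto ∘L π a ∘L E.subtypeL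
  map_add' a b := by ext; simp
  map_smul' c a := by ext; simp

/-- The noncommutative Hardy space `H² = [M]`: the closure of `M` in `L²(τ)`, where `L²(τ)` is the
completion of `A` for the inner product `⟪x, y⟫ = τ(x⋆ y)`. -/
def hardySpace (τ : A →ₚ[ℂ] ℂ) (M : NonUnitalSubalgebra ℂ A) : Submodule ℂ τ.GNS :=
  (Submodule.span ℂ ((fun a : A => (τ.toPreGNS a : τ.GNS)) '' (M : Set A))).topologicalClosure

instance hardySpace.instCompleteSpace (τ : A →ₚ[ℂ] ℂ) (M : NonUnitalSubalgebra ℂ A) :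
    CompleteSpace (hardySpace τ M) :=
  Submodule.topologicalClosure.completeSpace _

end CStarConvexity

end

/-! Write [h] for the class of h ∈ M in H². If φ = ∑ Tᵢ⋆ φᵢ(·) Tᵢ, positivity of the Gram matrices
(aₚ⋆ a_q) under each φᵢ makes every relation π(a)x = π(b)y with x, y ∈ H² pass to φᵢ(a)Tᵢx =
φᵢ(b)Tᵢy (`apply_eq_apply_of_compression_eq_sum`). Since π(b)[k] = π(bk)[1], this gives ⟨Tᵢ[h],
φᵢ(a) Tᵢ[k]⟩ = ω(h⋆ a k), where ω(x) = ⟨Tᵢ[1], φᵢ(x) Tᵢ[1]⟩.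

These functionals sum to τ, so ω ≤ τ, and a Radon-Nikodym theorem (`exists_density`) gives ω = τ(·
d) with 0 ≤ d in the algebra. As Tᵢ is bounded below and every positive invertible x is s⋆s with s ∈
M, τ is at most a multiple of ω on such x; this forces d to be invertible (`isUnit_of_trace_le`).

Factorization now writes d = s s⋆ with s, s⁻¹ ∈ M. Right multiplication Z by s is invertible on H²,
and the trace property turns ω(h⋆ a k) into τ((hs)⋆ a (ks)). Hence Tᵢ⋆ φᵢ(a) Tᵢ = Z⋆ φ(a) Z for all
a, and a = 1 shows that Z Tᵢ⁻¹ is unitary. -/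

noncomputable section

universe u v

/-! ### Negative parts in C⋆-algebras -/

section NegPart

variable {B : Type*} [NonUnitalCStarAlgebra B]

theorem eq_zero_of_mul_mul_self_eq_zero {b : B} (hb : IsSelfAdjoint b) (h : b * b * b = 0) :
    b = 0 := by
  have hb2 : b * b = 0 := by
    rw [← CStarRing.star_mul_self_eq_zero_iff, star_mul, hb.star_eq, ← mul_assoc, h, zero_mul]
  rwa [← CStarRing.star_mul_self_eq_zero_iff, hb.star_eq]

variable [PartialOrder B] [StarOrderedRing B]

theorem exists_eq_star_mul_self_of_nonneg {a : B} (ha : 0 ≤ a) : ∃ b, a = star b * b :=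
  CStarAlgebra.nonneg_iff_eq_star_mul_self.mp ha

/-- The defining properties of the negative part `b` of a self-adjoint element `a`. -/
theorem IsSelfAdjoint.exists_negPart {a : B} (ha : IsSelfAdjoint a) :
    ∃ b : B, 0 ≤ b ∧ a * b = -(b * b) ∧ (b = 0 → 0 ≤ a) := by
  refine ⟨a⁻, CFC.negPart_nonneg a, ?_, fun h => ?_⟩
  · nth_rewrite 1 [← CFC.posPart_sub_negPart a ha]
    rw [sub_mul, CFC.posPart_mul_negPart, zero_sub]
  · rw [← CFC.posPart_sub_negPart a ha, h, sub_zero]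
    exact CFC.posPart_nonneg a

theorem mul_mul_self_nonneg_of_nonneg {b : B} (hb : 0 ≤ b) : 0 ≤ b * b * b := by
  have := star_left_conjugate_nonneg hb b
  rwa [(IsSelfAdjoint.of_nonneg hb).star_eq] at this

end NegPart

/-! ### Positivity of operator matrices through their quadratic forms -/

namespace CStarMatrix

variable {n : Type*} [Fintype n] {H : Type v} [NormedAddCommGroup H] [InnerProductSpace ℂ H]

/-- The action of a matrix of operators on `H` on tuples of vectors of `H`. -/
def act (m : CStarMatrix n n (H →L[ℂ] H)) (h : n → H) (i : n) : H :=
  ∑ j, m i j (h j)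

theorem act_mul (m m' : CStarMatrix n n (H →L[ℂ] H)) (h : n → H) :
    (m * m').act h = m.act (m'.act h) := by
  ext i
  simp only [act, mul_apply, _root_.sum_apply, mul_apply_eq_comp,
    map_sum]
  exact Finset.sum_comm

theorem act_neg (m : CStarMatrix n n (H →L[ℂ] H)) (h : n → H) :
    (-m).act h = -m.act h := by
  ext i
  simp [act]

theorem eq_zero_of_act_eq_zero {m : CStarMatrix n n (H →L[ℂ] H)} (hm : ∀ h, m.act h = 0) :
    m = 0 := by
  classical
  ext i j x
  have := congrFun (hm (Pi.single j x)) i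
  rw [act, Finset.sum_eq_single j] at this
  · simpa using this
  · intro k _ hk
    simp [hk]
  · simp

variable [CompleteSpace H]

theorem sum_inner_act_star (m : CStarMatrix n n (H →L[ℂ] H)) (h g : n → H) :
    ∑ i, ⟪h i, (star m).act g i⟫_ℂ = ∑ i, ⟪m.act h i, g i⟫_ℂ := by
  simp only [act, star_apply, inner_sum, sum_inner, ContinuousLinearMap.star_eq_adjoint,
    ContinuousLinearMap.adjoint_inner_right]
  exact Finset.sum_comm

theorem sum_inner_act_star_mul_self (m : CStarMatrix n n (H →L[ℂ] H)) (h : n → H) :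
    ∑ i, ⟪h i, (star m * m).act h i⟫_ℂ = ((∑ i, ‖m.act h i‖ ^ 2 : ℝ) : ℂ) := by
  rw [act_mul, sum_inner_act_star]
  simp [inner_self_eq_norm_sq_to_K]

theorem sum_inner_act_nonneg {m : CStarMatrix n n (H →L[ℂ] H)} (hm : 0 ≤ m) (h : n → H) :
    0 ≤ ∑ i, ⟪h i, m.act h i⟫_ℂ := by
  classical
  obtain ⟨b, rfl⟩ := exists_eq_star_mul_self_of_nonneg hm
  rw [sum_inner_act_star_mul_self]
  exact Complex.zero_le_real.mpr (Finset.sum_nonneg fun i _ => sq_nonneg _)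

/-- A null vector of the form of a positive operator matrix is in its kernel. -/
theorem act_eq_zero_of_sum_inner_eq_zero {m : CStarMatrix n n (H →L[ℂ] H)} (hm : 0 ≤ m)
    {h : n → H} (h0 : ∑ i, ⟪h i, m.act h i⟫_ℂ = 0) : m.act h = 0 := by
  classical
  obtain ⟨b, rfl⟩ := exists_eq_star_mul_self_of_nonneg hm
  rw [sum_inner_act_star_mul_self] at h0
  have h1 := (Finset.sum_eq_zero_iff_of_nonneg fun i _ => sq_nonneg _).mp (Complex.ofReal_eq_zero.mp h0)
  have h2 : b.act h = 0 := by
    ext i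
    simpa using h1 i (Finset.mem_univ i)
  rw [act_mul, h2]
  ext i
  simp [act]

/-- A self-adjoint operator matrix whose form is positive is positive. -/
theorem nonneg_of_sum_inner_act_nonneg {m : CStarMatrix n n (H →L[ℂ] H)} (hm : IsSelfAdjoint m)
    (hpos : ∀ h : n → H, 0 ≤ ∑ i, ⟪h i, m.act h i⟫_ℂ) : 0 ≤ m := by
  classical
  obtain ⟨b, hb0, hbm, hm0⟩ := hm.exists_negPart
  have hbs : star b = b := (IsSelfAdjoint.of_nonneg hb0).star_eq
  have hb3 : 0 ≤ b * b * b := mul_mul_self_nonneg_of_nonneg hb0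
  have hzero : b * b * b = 0 := by
    refine eq_zero_of_act_eq_zero fun h => act_eq_zero_of_sum_inner_eq_zero hb3 ?_
    refine le_antisymm ?_ (sum_inner_act_nonneg hb3 h)
    -- At the tuple b h the form of m becomes that of b m b = -b³, so the form of b³ is also
    -- nonpositive.
    have h1 := hpos (b.act h)
    rw [← sum_inner_act_star, hbs, ← act_mul, ← act_mul, mul_assoc, hbm, mul_neg, ← mul_assoc,
      act_neg] at h1
    simpa using h1
  exact hm0 (eq_zero_of_mul_mul_self_eq_zero hbs hzero)

end CStarMatrix

/-! ### Compressions are unital completely positive -/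

section Compression

variable {A : Type u} [CStarAlgebra A]
  {L : Type v} [NormedAddCommGroup L] [InnerProductSpace ℂ L] [CompleteSpace L]

theorem inner_compression (π : A →⋆ₐ[ℂ] (L →L[ℂ] L)) (E : Submodule ℂ L) [CompleteSpace E]
    (a : A) (x y : E) : ⟪x, compression π E a y⟫_ℂ = ⟪(x : L), π a y⟫_ℂ := by
  exact Submodule.inner_orthogonalProjectionOnto_eq_of_mem_left x (π a y)

theorem star_compression (π : A →⋆ₐ[ℂ] (L →L[ℂ] L)) (E : Submodule ℂ L) [CompleteSpace E]
    (a : A) : star (compression π E a) = compression π E (star a) := by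
  rw [ContinuousLinearMap.star_eq_adjoint, eq_comm, ContinuousLinearMap.eq_adjoint_iff]
  intro x y
  rw [inner_compression, ← inner_conj_symm, inner_compression, map_star,
    ContinuousLinearMap.star_eq_adjoint, ContinuousLinearMap.adjoint_inner_right, inner_conj_symm]

variable [PartialOrder A] [StarOrderedRing A]

/-- On tuples from E, the compressed matrix has the same form as π applied entrywise to N, which is
again of the shape b⋆ b. -/
theorem compression_mem_generalizedStateSpace (π : A →⋆ₐ[ℂ] (L →L[ℂ] L)) (E : Submodule ℂ L)
    [CompleteSpace E] : compression π E ∈ generalizedStateSpace A E := by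
  refine ⟨?_, ⟨compression π E, fun k N hN => ?_⟩, rfl⟩
  · ext x
    simp [compression]
  · refine CStarMatrix.nonneg_of_sum_inner_act_nonneg ?_ fun h => ?_
    · rw [isSelfAdjoint_iff]
      ext i j : 2
      rw [CStarMatrix.star_apply, CStarMatrix.map_apply, CStarMatrix.map_apply, star_compression,
        CStarMatrix.star_apply_of_isSelfAdjoint (IsSelfAdjoint.of_nonneg hN)]
    · have hπN : 0 ≤ N.map π := by
        obtain ⟨b, rfl⟩ := exists_eq_star_mul_self_of_nonneg hN
        have hb : (star b * b).map π = star (b.map π) * b.map π := by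
          ext i j : 2
          simp only [CStarMatrix.map_apply, CStarMatrix.mul_apply, CStarMatrix.star_apply,
            map_sum, map_mul, map_star]
        rw [hb]
        exact star_mul_self_nonneg (b.map π)
      have h1 := CStarMatrix.sum_inner_act_nonneg hπN fun i => (h i : L)
      simpa only [CStarMatrix.act, inner_sum, CStarMatrix.map_apply, inner_compression] using h1

end Compression

open Filter

/-! ### GNS vectors and dominated functionals -/

namespace PositiveLinearMap

variable {A : Type u} [CStarAlgebra A] [PartialOrder A] [StarOrderedRing A] (τ : A →ₚ[ℂ] ℂ)

/-- The canonical map from `A` to the GNS space of `τ`. -/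
def toGNS : A →ₗ[ℂ] τ.GNS :=
  (UniformSpace.Completion.toComplL : τ.PreGNS →L[ℂ] τ.GNS).toLinearMap ∘ₗ
    τ.toPreGNS.toLinearMap

theorem toGNS_apply (a : A) : τ.toGNS a = (τ.toPreGNS a : τ.GNS) := rfl

theorem inner_toGNS (a b : A) : ⟪τ.toGNS a, τ.toGNS b⟫_ℂ = τ (star a * b) := by
  rw [toGNS_apply, toGNS_apply, UniformSpace.Completion.inner_coe, preGNS_inner_def,
    ofPreGNS_toPreGNS, ofPreGNS_toPreGNS]

theorem norm_toGNS_sq (a : A) : ((‖τ.toGNS a‖ ^ 2 : ℝ) : ℂ) = τ (star a * a) := by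
  rw [← inner_toGNS, inner_self_eq_norm_sq_to_K]
  simp

theorem denseRange_toGNS : DenseRange τ.toGNS :=
  UniformSpace.Completion.denseRange_coe (α := τ.PreGNS)

theorem gnsStarAlgHom_toGNS (a b : A) : τ.gnsStarAlgHom a (τ.toGNS b) = τ.toGNS (a * b) := by
  simp [toGNS_apply]

variable {τ}

/-- A positive functional dominated by `τ` is represented by a vector of the GNS space of `τ`. -/
theorem exists_inner_toGNS_eq {ω : A →ₚ[ℂ] ℂ} (hω : ∀ x, 0 ≤ x → ω x ≤ τ x) :
    ∃ ξ : τ.GNS, ∀ x, ⟪ξ, τ.toGNS x⟫_ℂ = ω x := by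
  -- Cauchy-Schwarz for ω followed by ω(x⋆x) ≤ τ(x⋆x) bounds ω in the norm of τ; Riesz
  -- representation then applies.
  have hbound (x : τ.PreGNS) :
      ‖(ω.toLinearMap ∘ₗ τ.ofPreGNS.toLinearMap) x‖ ≤ ‖ω.toGNS 1‖ * ‖x‖ := by
    have h1 : ‖ω (τ.ofPreGNS x)‖ ≤ ‖ω.toGNS 1‖ * ‖ω.toGNS (τ.ofPreGNS x)‖ := by
      have := norm_inner_le_norm (𝕜 := ℂ) (ω.toGNS 1) (ω.toGNS (τ.ofPreGNS x))
      rwa [inner_toGNS, star_one, one_mul] at this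
    refine h1.trans (mul_le_mul_of_nonneg_left ?_ (norm_nonneg _))
    have h2 : ‖ω.toGNS (τ.ofPreGNS x)‖ ^ 2 ≤ ‖τ.toGNS (τ.ofPreGNS x)‖ ^ 2 := by
      rw [← Complex.real_le_real, norm_toGNS_sq, norm_toGNS_sq]
      exact hω _ (star_mul_self_nonneg _)
    have h3 := le_of_sq_le_sq h2 (norm_nonneg _)
    rwa [toGNS_apply τ, toPreGNS_ofPreGNS, UniformSpace.Completion.norm_coe] at h3
  let F : τ.PreGNS →L[ℂ] ℂ := LinearMap.mkContinuous _ _ hbound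
  let e : τ.PreGNS →L[ℂ] τ.GNS := UniformSpace.Completion.toComplL
  refine ⟨(InnerProductSpace.toDual ℂ τ.GNS).symm (F.extend e), fun x => ?_⟩
  rw [InnerProductSpace.toDual_symm_apply]
  exact ContinuousLinearMap.extend_eq F UniformSpace.Completion.denseRange_coe
    (UniformSpace.Completion.isUniformInducing_coe _) (τ.toPreGNS x)

end PositiveLinearMap

/-! ### The representing vector is a limit of positive contractions -/

section Contractions

variable {A : Type u} [CStarAlgebra A] [PartialOrder A] [StarOrderedRing A]

/-- Up to `ε`, multiplication by some `0 ≤ d ≤ 1` turns a self-adjoint element into its positive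
part. -/
theorem IsSelfAdjoint.exists_mul_add_nonneg {a : A} (ha : IsSelfAdjoint a) {ε : ℝ} (hε : 0 < ε) :
    ∃ d : A, 0 ≤ d ∧ d ≤ 1 ∧ 0 ≤ a * d + algebraMap ℝ A ε ∧ a ≤ a * d + algebraMap ℝ A ε := by
  let f : ℝ → ℝ := fun t => min 1 (max t 0 / ε)
  have hf : Continuous f := by fun_prop
  have hf0 (t : ℝ) : 0 ≤ f t := by positivity
  have hmul : a * cfc f a + algebraMap ℝ A ε = cfc (fun t => t * f t + ε) a := by
    rw [cfc_add_const ε _ a, cfc_mul (fun t => t) f a, cfc_id' ℝ a]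
  have hle (t : ℝ) : max t 0 ≤ t * f t + ε := by
    rcases le_total t 0 with ht | ht
    · simp [f, max_eq_right ht, hε.le]
    · rw [max_eq_left ht]
      rcases le_total t ε with h | h
      · have := mul_nonneg ht (hf0 t)
        linarith
      · have : f t = 1 := by
          simp only [f, max_eq_left ht]
          exact min_eq_left ((one_le_div hε).mpr h)
        rw [this]
        linarith
  refine ⟨cfc f a, cfc_nonneg fun t _ => hf0 t, cfc_le_one _ _ fun t _ => min_le_left _ _, ?_, ?_⟩
  · rw [hmul]
    exact cfc_nonneg fun t _ => (le_max_right _ _).trans (hle t)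
  · rw [hmul]
    nth_rewrite 1 [← cfc_id' ℝ a]
    exact cfc_mono fun t _ => (le_max_left _ _).trans (hle t)

variable {τ ω : A →ₚ[ℂ] ℂ}

theorem PositiveLinearMap.norm_toGNS_le_of_le_one {d : A} (h0 : 0 ≤ d) (h1 : d ≤ 1) :
    ‖τ.toGNS d‖ ≤ ‖τ.toGNS 1‖ := by
  refine le_of_sq_le_sq ?_ (norm_nonneg _)
  rw [← Complex.real_le_real, norm_toGNS_sq, norm_toGNS_sq]
  refine OrderHomClass.mono τ ?_
  have hn : ‖d‖ ≤ 1 := (CStarAlgebra.norm_le_one_iff_of_nonneg d h0).mpr h1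
  rw [star_one, one_mul, ← CStarAlgebra.norm_le_one_iff_of_nonneg _ (star_mul_self_nonneg d),
    CStarRing.norm_star_mul_self]
  exact mul_le_one₀ hn (norm_nonneg _) hn

/-- This is the estimate that contradicts a Hahn-Banach separation of the vector of ω from the unit
interval: τ(a d) is nearly τ of the positive part of a, which dominates ω(a). -/
theorem PositiveLinearMap.exists_re_le_re_mul_add (hω : ∀ x, 0 ≤ x → ω x ≤ τ x) {a : A}
    (ha : IsSelfAdjoint a) {ε : ℝ} (hε : 0 < ε) :
    ∃ d : A, 0 ≤ d ∧ d ≤ 1 ∧ (ω a).re ≤ (τ (a * d)).re + ε * (τ 1).re := by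
  obtain ⟨d, h0, h1, hp, hle⟩ := ha.exists_mul_add_nonneg hε
  refine ⟨d, h0, h1, ?_⟩
  have h := (OrderHomClass.mono ω hle).trans (hω _ hp)
  have h' := (Complex.le_def.mp h).1
  rw [map_add, Algebra.algebraMap_eq_smul_one, ← Complex.coe_smul, map_smul] at h'
  simpa using h'

/-- The vector representing a functional dominated by the trace `τ` is a limit of elements of the
unit interval of `A`. -/
theorem PositiveLinearMap.mem_closure_toGNS_Icc (hcomm : ∀ x y, τ (x * y) = τ (y * x))
    (hω : ∀ x, 0 ≤ x → ω x ≤ τ x) {ξ : τ.GNS} (hξ : ∀ x, ⟪ξ, τ.toGNS x⟫_ℂ = ω x) :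
    ξ ∈ closure (τ.toGNS '' Set.Icc 0 1) := by
  by_contra hmem
  have hconv : Convex ℝ (closure (τ.toGNS '' Set.Icc 0 1)) :=
    ((convex_Icc (0 : A) 1).is_linear_image (f := τ.toGNS)
      ⟨map_add _, fun c x => by
        rw [← Complex.coe_smul, map_smul, Complex.coe_smul]⟩).closure
  obtain ⟨F, u, hF, hFξ⟩ :=
    RCLike.geometric_hahn_banach_closed_point (𝕜 := ℂ) hconv isClosed_closure hmem
  set η := (InnerProductSpace.toDual ℂ τ.GNS).symm F with hη
  have hFη (x : τ.GNS) : F x = ⟪η, x⟫_ℂ := by simp [hη]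
  -- The first three terms collect the errors, in units of δ, from replacing η by a at ξ and at d
  -- and from the choice of d; the 1 keeps C positive.
  set C := ‖ξ‖ + ‖τ.toGNS 1‖ + (τ 1).re + 1 with hC
  have hτ1 : 0 ≤ (τ 1).re := (Complex.le_def.mp (τ.map_nonneg zero_le_one)).1
  have hC0 : 0 < C := by positivity
  set δ := (RCLike.re (F ξ) - u) / C with hδ
  have hδ0 : 0 < δ := div_pos (sub_pos.mpr hFξ) hC0
  obtain ⟨a, ha⟩ := τ.denseRange_toGNS.exists_dist_lt η hδ0
  have happrox (x : τ.GNS) : |RCLike.re (F x) - (⟪τ.toGNS a, x⟫_ℂ).re| ≤ δ * ‖x‖ := by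
    have h1 : RCLike.re (F x) - (⟪τ.toGNS a, x⟫_ℂ).re = (⟪η - τ.toGNS a, x⟫_ℂ).re := by
      rw [hFη, inner_sub_left]
      simp
    rw [h1]
    refine (Complex.abs_re_le_norm _).trans ((norm_inner_le_norm _ _).trans ?_)
    rw [← dist_eq_norm]
    exact mul_le_mul_of_nonneg_right ha.le (norm_nonneg _)
  obtain ⟨d, h0, h1, hd⟩ := exists_re_le_re_mul_add hω (IsSelfAdjoint.add_star_self a)
    (mul_pos two_pos hδ0)
  have hds : star d = d := (IsSelfAdjoint.of_nonneg h0).star_eq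
  have hωb : (ω (a + star a)).re = 2 * (⟪τ.toGNS a, ξ⟫_ℂ).re := by
    rw [← inner_conj_symm, hξ, map_add, map_star]
    simp
    ring
  have hτd : (τ ((a + star a) * d)).re = 2 * (⟪τ.toGNS a, τ.toGNS d⟫_ℂ).re := by
    -- The trace property enters here: it lets d pass to the other side of a.
    have h2 : τ (a * d) = star (τ (star a * d)) := by
      rw [← map_star, star_mul, star_star, hds, hcomm]
    rw [inner_toGNS, add_mul, map_add, h2]
    simp
    ring
  rw [hωb, hτd] at hd
  have h3 := (abs_le.mp (happrox ξ)).2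
  have h4 := (abs_le.mp (happrox (τ.toGNS d))).1
  have h5 := hF _ (subset_closure ⟨d, ⟨h0, h1⟩, rfl⟩)
  have h6 : δ * ‖τ.toGNS d‖ ≤ δ * ‖τ.toGNS 1‖ :=
    mul_le_mul_of_nonneg_left (norm_toGNS_le_of_le_one h0 h1) hδ0.le
  have h7 : δ * C = RCLike.re (F ξ) - u := div_mul_cancel₀ _ hC0.ne'
  rw [hC] at h7
  nlinarith

end Contractions

/-! ### Weak limits of bounded families of operators -/

section WeakLimit

variable {K : Type u} [NormedAddCommGroup K] [InnerProductSpace ℂ K]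

theorem ContinuousLinearMap.nonneg_of_tendsto_inner {ι : Type*} {l : Filter ι} [l.NeBot]
    {T : ι → K →L[ℂ] K} {D : K →L[ℂ] K} (hT : ∀ i, 0 ≤ T i)
    (hD : ∀ x y, Tendsto (fun i => ⟪x, T i y⟫_ℂ) l (𝓝 ⟪x, D y⟫_ℂ)) : 0 ≤ D := by
  rw [ContinuousLinearMap.nonneg_iff_isPositive]
  refine ⟨fun x y => ?_, fun x => ?_⟩
  · refine tendsto_nhds_unique ?_ (hD x y)
    have h := (hD y x).star
    simp only [RCLike.star_def, inner_conj_symm] at h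
    refine h.congr fun i => ?_
    exact ((ContinuousLinearMap.nonneg_iff_isPositive _).mp (hT i)).isSymmetric x y
  · have h := ge_of_tendsto' (hD x x) (b := 0) fun i =>
      ((ContinuousLinearMap.nonneg_iff_isPositive _).mp (hT i)).inner_nonneg_right x
    rw [ContinuousLinearMap.reApplyInnerSelf_apply, inner_re_symm]
    exact (Complex.le_def.mp h).1

variable [CompleteSpace K]

/-- Bounded families of operators converge weakly along ultrafilters. -/
theorem ContinuousLinearMap.exists_tendsto_inner {ι : Type*} (U : Ultrafilter ι)
    (T : ι → K →L[ℂ] K) {C : ℝ} (hT : ∀ i, ‖T i‖ ≤ C) :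
    ∃ D : K →L[ℂ] K, ∀ x y, Tendsto (fun i => ⟪x, T i y⟫_ℂ) U (𝓝 ⟪x, D y⟫_ℂ) := by
  have hbound (x y : K) (i : ι) : ‖⟪T i x, y⟫_ℂ‖ ≤ C * ‖x‖ * ‖y‖ :=
    (norm_inner_le_norm _ _).trans
      (mul_le_mul_of_nonneg_right ((T i).le_of_opNorm_le (hT i) x) (norm_nonneg _))
  have hlim (x y : K) : ∃ c ∈ Metric.closedBall (0 : ℂ) (C * ‖x‖ * ‖y‖),
      Tendsto (fun i => ⟪T i x, y⟫_ℂ) U (𝓝 c) := by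
    refine (isCompact_closedBall (0 : ℂ) (C * ‖x‖ * ‖y‖)).ultrafilter_le_nhds
      (U.map fun i => ⟪T i x, y⟫_ℂ) ?_
    rw [le_principal_iff]
    exact mem_map.mpr (univ_mem' fun i => mem_closedBall_zero_iff.mpr (hbound x y i))
  choose b hb hlim using hlim
  let B : K →ₗ⋆[ℂ] K →ₗ[ℂ] ℂ := LinearMap.mk₂'ₛₗ _ _ b
    (fun x x' y => tendsto_nhds_unique (hlim _ y) (by
      simpa only [map_add, inner_add_left] using (hlim x y).add (hlim x' y)))
    (fun c x y => tendsto_nhds_unique (hlim _ y) (by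
      simpa only [map_smul, inner_smul_left, smul_eq_mul] using (hlim x y).const_smul (starRingEnd ℂ c)))
    (fun x y y' => tendsto_nhds_unique (hlim x _) (by
      simpa only [inner_add_right] using (hlim x y).add (hlim x y')))
    (fun c x y => tendsto_nhds_unique (hlim x _) (by
      simpa only [inner_smul_right, smul_eq_mul, RingHom.id_apply] using (hlim x y).const_smul c))
  let B' : K →L⋆[ℂ] K →L[ℂ] ℂ :=
    LinearMap.mkContinuous₂ B C fun x y => mem_closedBall_zero_iff.mp (hb x y)
  refine ⟨InnerProductSpace.continuousLinearMapOfBilin B', fun x y => ?_⟩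
  have h : ⟪x, InnerProductSpace.continuousLinearMapOfBilin B' y⟫_ℂ = star (b y x) := by
    rw [← inner_conj_symm, InnerProductSpace.continuousLinearMapOfBilin_apply]
    rfl
  rw [h]
  have h' : (fun i => ⟪x, T i y⟫_ℂ) = fun i => star ⟪T i y, x⟫_ℂ := by
    ext i
    exact (inner_conj_symm _ _).symm
  rw [h']
  exact (hlim y x).star

end WeakLimit

/-! ### Radon-Nikodym densities in a von Neumann algebra -/

namespace VonNeumannAlgebra

variable {K : Type u} [NormedAddCommGroup K] [InnerProductSpace ℂ K] [CompleteSpace K]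
  (A : VonNeumannAlgebra K)

/-- Commuting with the commutant survives weak limits, so the bicommutant theorem applies. -/
theorem mem_of_tendsto_inner {ι : Type*} {l : Filter ι} [l.NeBot] {T : ι → A}
    {D : K →L[ℂ] K}
    (hD : ∀ x y, Tendsto (fun i => ⟪x, (T i : K →L[ℂ] K) y⟫_ℂ) l (𝓝 ⟪x, D y⟫_ℂ)) : D ∈ A := by
  rw [← SetLike.mem_coe, ← A.centralizer_centralizer, Set.mem_centralizer_iff]
  intro m hm
  ext y
  refine ext_inner_left ℂ fun x => ?_
  have h1 := hD (ContinuousLinearMap.adjoint m x) y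
  simp only [ContinuousLinearMap.adjoint_inner_left] at h1
  refine tendsto_nhds_unique h1 ((hD x (m y)).congr fun i => ?_)
  have := congrArg (fun S : K →L[ℂ] K => S y) (Set.mem_centralizer_iff.mp hm _ (T i).2)
  exact congrArg (fun z => ⟪x, z⟫_ℂ) this

/-- Bounded weakly convergent families converge ultraweakly. -/
theorem tendsto_ultraweak {ι : Type*} {l : Filter ι} {T : ι → A} {D : A} {C : ℝ}
    (hC : ∀ i, ‖T i‖ ≤ C)
    (hD : ∀ x y, Tendsto (fun i => ⟪x, (T i : K →L[ℂ] K) y⟫_ℂ) l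
      (𝓝 ⟪x, (D : K →L[ℂ] K) y⟫_ℂ)) :
    Tendsto T l (@nhds _ A.ultraweakTopology D) := by
  simp only [nhds_iInf, tendsto_iInf, nhds_induced, tendsto_comap_iff]
  intro ξ η hξ hη
  refine tendsto_tsum_of_dominated_convergence
    (bound := fun n => C * (‖ξ n‖ ^ 2 + ‖η n‖ ^ 2)) ((hξ.add hη).mul_left C)
    (fun n => hD _ _) (Eventually.of_forall fun i n => ?_)
  have hC0 : 0 ≤ C := (norm_nonneg _).trans (hC i)
  calc ‖⟪ξ n, (T i : K →L[ℂ] K) (η n)⟫_ℂ‖ ≤ ‖ξ n‖ * (C * ‖η n‖) :=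
        (norm_inner_le_norm _ _).trans (mul_le_mul_of_nonneg_left
          ((T i : K →L[ℂ] K).le_of_opNorm_le (hC i) _) (norm_nonneg _))
    _ = C * (‖ξ n‖ * ‖η n‖) := by ring
    _ ≤ C * (‖ξ n‖ ^ 2 + ‖η n‖ ^ 2) := by
        refine mul_le_mul_of_nonneg_left ?_ hC0
        nlinarith [sq_nonneg (‖ξ n‖ - ‖η n‖), sq_nonneg ‖ξ n‖, sq_nonneg ‖η n‖]

variable {A}

/-- The Radon-Nikodym theorem for functionals dominated by a finite trace. -/
theorem IsFaithfulNormalTrace.exists_density {τ : A →ₚ[ℂ] ℂ} (hτ : A.IsFaithfulNormalTrace τ)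
    {ω : A →ₚ[ℂ] ℂ} (hω : ∀ x, 0 ≤ x → ω x ≤ τ x) :
    ∃ d : A, 0 ≤ d ∧ ∀ x, ω x = τ (x * d) := by
  obtain ⟨ξ, hξ⟩ := PositiveLinearMap.exists_inner_toGNS_eq hω
  obtain ⟨v, hv, hvξ⟩ := mem_closure_iff_seq_limit.mp
    (PositiveLinearMap.mem_closure_toGNS_Icc hτ.map_mul_comm hω hξ)
  choose T hT hTv using hv
  have hT1 (i : ℕ) : ‖T i‖ ≤ 1 :=
    (CStarAlgebra.norm_le_one_iff_of_nonneg _ (hT i).1).mpr (hT i).2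
  obtain ⟨D, hD⟩ := ContinuousLinearMap.exists_tendsto_inner (hyperfilter ℕ)
    (fun i => (T i : K →L[ℂ] K)) hT1
  have hD0 : 0 ≤ D := ContinuousLinearMap.nonneg_of_tendsto_inner (fun i => (hT i).1) hD
  refine ⟨⟨D, A.mem_of_tendsto_inner hD⟩, hD0, fun x => ?_⟩
  -- The numbers τ(x Tᵢ) tend to ω(x) by norm convergence in the GNS space, and to τ(x D) by
  -- normality, since x Tᵢ → x D ultraweakly.
  have h1 : Tendsto (fun i => τ (x * T i)) (hyperfilter ℕ) (𝓝 (ω x)) := by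
    have h2 : Tendsto (fun i => ⟪τ.toGNS (star x), v i⟫_ℂ) atTop
        (𝓝 ⟪τ.toGNS (star x), ξ⟫_ℂ) := tendsto_const_nhds.inner hvξ
    rw [← inner_conj_symm, hξ, map_star ω, RCLike.star_def, Complex.conj_conj] at h2
    refine (h2.mono_left Nat.hyperfilter_le_atTop).congr fun i => ?_
    rw [← hTv, PositiveLinearMap.inner_toGNS, star_star]
  refine tendsto_nhds_unique h1 ?_
  have h3 : Tendsto (fun i => x * T i) (hyperfilter ℕ)
      (@nhds _ A.ultraweakTopology (x * ⟨D, A.mem_of_tendsto_inner hD⟩)) := by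
    refine A.tendsto_ultraweak (C := ‖x‖)
      (fun i => (norm_mul_le _ _).trans (mul_le_of_le_one_right (norm_nonneg _) (hT1 i)))
      fun y z => ?_
    have := hD (ContinuousLinearMap.adjoint (x : K →L[ℂ] K) y) z
    simp only [ContinuousLinearMap.adjoint_inner_left] at this
    exact this
  exact (@Continuous.tendsto _ _ A.ultraweakTopology _ _ hτ.normal _).comp h3

end VonNeumannAlgebra

/-! ### Relations inherited by the summands of a C⋆-combination -/

section GeneralizedStateSpace

variable {A : Type u} [CStarAlgebra A] [PartialOrder A] [StarOrderedRing A]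
  {H : Type v} [NormedAddCommGroup H] [InnerProductSpace ℂ H] [CompleteSpace H]

/-- The Gram matrix is b⋆ b, where b has first row a and zeros elsewhere. -/
theorem CStarMatrix.ofMatrix_star_mul_nonneg {k : ℕ} (a : Fin (k + 1) → A) :
    0 ≤ CStarMatrix.ofMatrix (Matrix.of fun i j => star (a i) * a j) := by
  have h : CStarMatrix.ofMatrix (Matrix.of fun i j => star (a i) * a j) =
      star (CStarMatrix.ofMatrix (Matrix.of fun (i : Fin (k + 1)) j => if i = 0 then a j else 0)) *
        CStarMatrix.ofMatrix (Matrix.of fun (i : Fin (k + 1)) j => if i = 0 then a j else 0) := by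
    ext i j
    rw [CStarMatrix.mul_apply, Finset.sum_eq_single 0]
    · simp [CStarMatrix.star_apply]
    · intro l _ hl
      simp [hl]
    · simp
  rw [h]
  exact star_mul_self_nonneg _

namespace generalizedStateSpace

variable {φ : A →ₗ[ℂ] (H →L[ℂ] H)}

theorem map_star (hφ : φ ∈ generalizedStateSpace A H) (a : A) : φ (star a) = star (φ a) := by
  obtain ⟨-, ψ, rfl⟩ := hφ
  exact StarHomClass.map_star ψ a

theorem map_nonneg (hφ : φ ∈ generalizedStateSpace A H) {a : A} (ha : 0 ≤ a) : 0 ≤ φ a := by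
  obtain ⟨-, ψ, rfl⟩ := hφ
  exact _root_.map_nonneg ψ ha

theorem map_star_mul_nonneg (hφ : φ ∈ generalizedStateSpace A H) {k : ℕ} (a : Fin (k + 1) → A) :
    0 ≤ (CStarMatrix.ofMatrix (Matrix.of fun i j => star (a i) * a j)).map φ := by
  obtain ⟨-, ψ, rfl⟩ := hφ
  exact ψ.map_cstarMatrix_nonneg' _ _ (CStarMatrix.ofMatrix_star_mul_nonneg a)

/-- The positive functional `a ↦ ⟪v, φ a v⟫`. -/
theorem exists_vectorFunctional (hφ : φ ∈ generalizedStateSpace A H) (v : H) :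
    ∃ ω : A →ₚ[ℂ] ℂ, ∀ a, ω a = ⟪v, φ a v⟫_ℂ :=
  ⟨PositiveLinearMap.mk₀
    { toFun := fun a => ⟪v, φ a v⟫_ℂ
      map_add' := fun a b => by simp
      map_smul' := fun c a => by simp }
    fun _ ha => ((ContinuousLinearMap.nonneg_iff_isPositive _).mp
      (map_nonneg hφ ha)).inner_nonneg_right v, fun _ => rfl⟩

end generalizedStateSpace

variable {L : Type v} [NormedAddCommGroup L] [InnerProductSpace ℂ L] [CompleteSpace L]

/-- If the compression of a representation `π` is a `C⋆`-combination of the `φᵢ`, then every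
relation `π(a) x = π(b) y` is inherited by each `φᵢ`. -/
theorem apply_eq_apply_of_compression_eq_sum {π : A →⋆ₐ[ℂ] (L →L[ℂ] L)} {E : Submodule ℂ L}
    [CompleteSpace E] {n : ℕ} {T : Fin n → (E →L[ℂ] E)} {φs : Fin n → (A →ₗ[ℂ] (E →L[ℂ] E))}
    (hφs : ∀ i, φs i ∈ generalizedStateSpace A E)
    (hsum : ∀ a, compression π E a = ∑ i, star (T i) * φs i a * T i)
    {a b : A} {x y : E} (h : π a x = π b y) (i : Fin n) :
    φs i a (T i x) = φs i b (T i y) := by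
  -- The entry 1 carries the vector 0, so it leaves the form unchanged; its row of the matrix reads
  -- off φᵢ(a)Tᵢx - φᵢ(b)Tᵢy.
  let c : Fin 3 → A := ![a, b, 1]
  let w : Fin 3 → E := ![x, -y, 0]
  let m (i : Fin n) : CStarMatrix (Fin 3) (Fin 3) (E →L[ℂ] E) :=
    (CStarMatrix.ofMatrix (Matrix.of fun i j => star (c i) * c j)).map (φs i)
  have hm (i : Fin n) : 0 ≤ m i := generalizedStateSpace.map_star_mul_nonneg (hφs i) c
  have hterm (p q : Fin 3) : ∑ i, ⟪T i (w p), φs i (star (c p) * c q) (T i (w q))⟫_ℂ =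
      ⟪π (c p) (w p), π (c q) (w q)⟫_ℂ := by
    have h1 := inner_compression π E (star (c p) * c q) (w p) (w q)
    rw [hsum, _root_.sum_apply, inner_sum, map_mul, map_star,
      ContinuousLinearMap.star_eq_adjoint, mul_apply_eq_comp,
      ContinuousLinearMap.adjoint_inner_right] at h1
    rw [← h1]
    refine Finset.sum_congr rfl fun i _ => ?_
    rw [mul_apply_eq_comp, mul_apply_eq_comp, ContinuousLinearMap.star_eq_adjoint,
      ContinuousLinearMap.adjoint_inner_right]
  -- The forms add up to ‖π(a)x - π(b)y‖² = 0; each is nonnegative, so each vanishes.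
  have hzero : ∑ i, ∑ p, ⟪T i (w p), (m i).act (fun q => T i (w q)) p⟫_ℂ = 0 := by
    have h2 : ∑ i, ∑ p, ⟪T i (w p), (m i).act (fun q => T i (w q)) p⟫_ℂ =
        ∑ p, ∑ q, ⟪π (c p) (w p), π (c q) (w q)⟫_ℂ := by
      simp only [← hterm]
      rw [Finset.sum_comm]
      refine Finset.sum_congr rfl fun p _ => ?_
      rw [Finset.sum_comm]
      refine Finset.sum_congr rfl fun i _ => ?_
      exact inner_sum _ _ _
    have h3 : ∑ p, π (c p) (w p) = 0 := by
      simp [Fin.sum_univ_three, c, w, h]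
    rw [h2]
    simp only [← inner_sum]
    rw [← sum_inner, h3, inner_zero_left]
  have hi := (Finset.sum_eq_zero_iff_of_nonneg fun i _ =>
    CStarMatrix.sum_inner_act_nonneg (hm i) fun p => T i (w p)).mp hzero i (Finset.mem_univ i)
  have h4 := congrFun (CStarMatrix.act_eq_zero_of_sum_inner_eq_zero (hm i) hi) 2
  simpa [CStarMatrix.act, Fin.sum_univ_three, m, c, w, ← sub_eq_add_neg, sub_eq_zero] using h4

end GeneralizedStateSpace

/-! ### Right multiplication and invertible densities for a trace -/

section Trace

variable {A : Type u} [CStarAlgebra A] [PartialOrder A] [StarOrderedRing A] {τ : A →ₚ[ℂ] ℂ}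

theorem PositiveLinearMap.norm_toGNS_star (hcomm : ∀ x y, τ (x * y) = τ (y * x)) (a : A) :
    ‖τ.toGNS (star a)‖ = ‖τ.toGNS a‖ := by
  refine (sq_eq_sq₀ (norm_nonneg _) (norm_nonneg _)).mp (Complex.ofReal_injective ?_)
  rw [norm_toGNS_sq, norm_toGNS_sq, star_star, hcomm]

/-- Right multiplication on the GNS space of a trace. -/
theorem PositiveLinearMap.exists_rightMul (hcomm : ∀ x y, τ (x * y) = τ (y * x)) (s : A) :
    ∃ R : τ.GNS →L[ℂ] τ.GNS, ∀ a, R (τ.toGNS a) = τ.toGNS (a * s) := by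
  let F₀ : τ.PreGNS →ₗ[ℂ] τ.GNS :=
    τ.toGNS ∘ₗ (LinearMap.mulRight ℂ s) ∘ₗ τ.ofPreGNS.toLinearMap
  have hbound (x : τ.PreGNS) : ‖F₀ x‖ ≤ ‖τ.gnsStarAlgHom (star s)‖ * ‖x‖ := by
    -- Since ⋆ is isometric for a trace, right multiplication by s is bounded as left multiplication
    -- by s⋆ is.
    have h1 : ‖F₀ x‖ = ‖τ.gnsStarAlgHom (star s) (τ.toGNS (star (τ.ofPreGNS x)))‖ := by
      rw [gnsStarAlgHom_toGNS, ← star_mul, norm_toGNS_star hcomm]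
      rfl
    have h2 : ‖x‖ = ‖τ.toGNS (star (τ.ofPreGNS x))‖ := by
      rw [norm_toGNS_star hcomm, toGNS_apply, toPreGNS_ofPreGNS,
        UniformSpace.Completion.norm_coe]
    rw [h1, h2]
    exact ContinuousLinearMap.le_opNorm _ _
  let F : τ.PreGNS →L[ℂ] τ.GNS := LinearMap.mkContinuous F₀ _ hbound
  let e : τ.PreGNS →L[ℂ] τ.GNS := UniformSpace.Completion.toComplL
  exact ⟨F.extend e, fun a => ContinuousLinearMap.extend_eq F
    (UniformSpace.Completion.denseRange_coe (α := τ.PreGNS))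
    (UniformSpace.Completion.isUniformInducing_coe _) (τ.toPreGNS a)⟩

/-- A density that bounds a faithful trace from above is invertible. -/
theorem isUnit_of_trace_le (hcomm : ∀ x y, τ (x * y) = τ (y * x))
    (hfaith : ∀ x, τ (star x * x) = 0 → x = 0) {d : A} (hd : 0 ≤ d) {c : ℝ}
    (h : ∀ x, 0 ≤ x → IsUnit x → τ x ≤ c * τ (x * d)) : IsUnit d := by
  have hsa : IsSelfAdjoint ((c : ℂ) • d - 1) := by
    rw [Complex.coe_smul]
    exact ((IsSelfAdjoint.all c).smul (IsSelfAdjoint.of_nonneg hd)).sub (.one A)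
  obtain ⟨b, hb, heb, hpos⟩ := hsa.exists_negPart
  have hbs : star b = b := (IsSelfAdjoint.of_nonneg hb).star_eq
  -- The aim is to test the inequality at the negative part b of c d - 1, giving -τ(b²) ≥ 0. As only
  -- invertible elements are allowed, b + δ is used and δ tends to 0.
  have hδ (δ : ℝ) (hδ : 0 < δ) : 0 ≤ (τ (b * ((c : ℂ) • d - 1))).re +
      δ * (τ ((c : ℂ) • d - 1)).re := by
    have hx0 : 0 ≤ algebraMap ℝ A δ := by
      rw [Algebra.algebraMap_eq_smul_one]
      exact smul_nonneg hδ.le zero_le_one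
    have hu : IsUnit (algebraMap ℝ A δ) := (IsUnit.mk0 δ hδ.ne').map (algebraMap ℝ A)
    have hx : IsUnit (b + algebraMap ℝ A δ) :=
      CStarAlgebra.isUnit_of_le (algebraMap ℝ A δ) (le_add_of_nonneg_left hb)
        ⟨hx0, hu⟩
    have h1 := sub_nonneg.mpr (h _ (add_nonneg hb hx0) hx)
    have h2 : (c : ℂ) * τ ((b + algebraMap ℝ A δ) * d) - τ (b + algebraMap ℝ A δ) =
        τ (b * ((c : ℂ) • d - 1)) + δ * τ ((c : ℂ) • d - 1) := by
      rw [Algebra.algebraMap_eq_smul_one, ← Complex.coe_smul, add_mul, smul_mul_assoc, one_mul,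
        mul_sub, mul_smul_comm, mul_one]
      simp only [map_add, map_sub, map_smul, smul_eq_mul]
      ring
    rw [h2] at h1
    simpa using (Complex.le_def.mp h1).1
  have hre : 0 ≤ (τ (b * ((c : ℂ) • d - 1))).re := by
    have hlim : Filter.Tendsto (fun δ : ℝ => (τ (b * ((c : ℂ) • d - 1))).re +
        δ * (τ ((c : ℂ) • d - 1)).re) (𝓝[>] 0) (𝓝 (τ (b * ((c : ℂ) • d - 1))).re) := by
      refine tendsto_nhdsWithin_of_tendsto_nhds ?_
      have : Continuous fun δ : ℝ => (τ (b * ((c : ℂ) • d - 1))).re +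
        δ * (τ ((c : ℂ) • d - 1)).re := by fun_prop
      simpa using this.tendsto 0
    refine ge_of_tendsto hlim ?_
    filter_upwards [self_mem_nhdsWithin] with δ hδ0 using hδ δ hδ0
  have hb0 : b = 0 := by
    refine hfaith b (le_antisymm ?_ (τ.map_nonneg (star_mul_self_nonneg b)))
    have h3 : 0 ≤ τ (star b * b) := τ.map_nonneg (star_mul_self_nonneg b)
    rw [hcomm, heb, map_neg] at hre
    rw [hbs] at h3 ⊢
    rw [Complex.le_def] at h3 ⊢
    exact ⟨by simpa using hre, h3.2.symm⟩
  have hle : 1 ≤ (c : ℂ) • d := sub_nonneg.mp (hpos hb0)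
  have hu := CStarAlgebra.isUnit_of_le 1 hle ⟨zero_le_one, isUnit_one⟩
  -- If c = 0, then 0 is invertible and the algebra is trivial.
  by_cases hc : (c : ℂ) = 0
  · rw [hc, zero_smul] at hu
    have := subsingleton_of_zero_eq_one (isUnit_zero_iff.mp hu)
    exact isUnit_of_subsingleton d
  · exact (isUnit_smul_iff (Units.mk0 (c : ℂ) hc) d).mp hu

end Trace

/-! ### Factorization and right multiplication on the Hardy space -/

section Factorization

variable {A : Type u} [CStarAlgebra A] [PartialOrder A] [StarOrderedRing A]
  {M : NonUnitalSubalgebra ℂ A}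

theorem HasFactorization.one_mem (hM : HasFactorization M) : (1 : A) ∈ M := by
  obtain ⟨s, hs, hs', -⟩ := hM 1 zero_le_one isUnit_one
  simpa using M.mul_mem hs hs'

/-- Factor d⁻¹ = t⋆ t and take s = t⁻¹; the hypothesis is symmetric in t and t⁻¹. -/
theorem HasFactorization.exists_mul_star (hM : HasFactorization M) {d : A} (hd : 0 ≤ d)
    (hu : IsUnit d) :
    ∃ s : Aˣ, (s : A) ∈ M ∧ ((s⁻¹ : Aˣ) : A) ∈ M ∧ d = s * star (s : A) := by
  obtain ⟨d, rfl⟩ := hu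
  have hinv : 0 ≤ ((d⁻¹ : Aˣ) : A) := by
    have hds : star d = d := Units.ext (IsSelfAdjoint.of_nonneg hd).star_eq
    have h := star_left_conjugate_nonneg hd ((d⁻¹ : Aˣ) : A)
    rwa [← Units.coe_star, star_inv, hds, Units.inv_mul, one_mul] at h
  obtain ⟨t, ht, ht', h⟩ := hM _ hinv d⁻¹.isUnit
  refine ⟨t⁻¹, ht', by simpa using ht, ?_⟩
  have h' : d⁻¹ = star t * t := Units.ext h
  rw [← Units.coe_star, ← Units.val_mul, star_inv, ← mul_inv_rev, ← h', inv_inv]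

variable (τ : A →ₚ[ℂ] ℂ)

theorem coe_hardySpace (M : NonUnitalSubalgebra ℂ A) :
    (hardySpace τ M : Set τ.GNS) = closure (τ.toGNS '' (M : Set A)) := by
  have h : Submodule.span ℂ (τ.toGNS '' (M : Set A)) = M.toSubmodule.map τ.toGNS :=
    Submodule.span_eq (M.toSubmodule.map τ.toGNS)
  change closure (Submodule.span ℂ (τ.toGNS '' (M : Set A)) : Set τ.GNS) = _
  rw [h]
  rfl

/-- The class of an element of `M` in the Hardy space. -/
def toHardySpace (M : NonUnitalSubalgebra ℂ A) (h : M) : hardySpace τ M :=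
  ⟨τ.toGNS h, by
    rw [← SetLike.mem_coe, coe_hardySpace]
    exact subset_closure ⟨h, h.2, rfl⟩⟩

theorem denseRange_toHardySpace (M : NonUnitalSubalgebra ℂ A) :
    DenseRange (toHardySpace τ M) := by
  refine Topology.IsInducing.subtypeVal.dense_iff.mpr fun x => ?_
  have hx : (x : τ.GNS) ∈ closure (τ.toGNS '' (M : Set A)) := by
    rw [← coe_hardySpace]
    exact x.2
  convert hx using 2
  ext y
  constructor
  · rintro ⟨_, ⟨h, rfl⟩, rfl⟩
    exact ⟨h, h.2, rfl⟩
  · rintro ⟨h, hh, rfl⟩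
    exact ⟨_, ⟨⟨h, hh⟩, rfl⟩, rfl⟩

variable {τ}

theorem hardySpace_operator_ext {P Q : hardySpace τ M →L[ℂ] hardySpace τ M}
    (h : ∀ x y : M, ⟪toHardySpace τ M x, P (toHardySpace τ M y)⟫_ℂ =
      ⟪toHardySpace τ M x, Q (toHardySpace τ M y)⟫_ℂ) : P = Q := by
  have h1 (y : M) : P (toHardySpace τ M y) = Q (toHardySpace τ M y) := by
    refine ext_inner_left ℂ fun v => ?_
    refine congrFun (DenseRange.equalizer (denseRange_toHardySpace τ M)
      (f := toHardySpace τ M) (g := fun v => ⟪v, P (toHardySpace τ M y)⟫_ℂ)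
      (h := fun v => ⟪v, Q (toHardySpace τ M y)⟫_ℂ)
      (by fun_prop) (by fun_prop) (funext fun x => h x y)) v
  exact ContinuousLinearMap.ext (congrFun ((denseRange_toHardySpace τ M).equalizer
    P.continuous Q.continuous (funext h1)))

/-- Right multiplication by an element of `M` acts on the Hardy space. -/
theorem exists_hardySpace_rightMul (hcomm : ∀ x y, τ (x * y) = τ (y * x)) (s : M) :
    ∃ Z : hardySpace τ M →L[ℂ] hardySpace τ M,
      ∀ h : M, Z (toHardySpace τ M h) = toHardySpace τ M (h * s) := by
  obtain ⟨R, hR⟩ := PositiveLinearMap.exists_rightMul hcomm (s : A)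
  have hmem (x : hardySpace τ M) : (R ∘L (hardySpace τ M).subtypeL) x ∈ hardySpace τ M := by
    have hmaps : Set.MapsTo R (τ.toGNS '' (M : Set A)) (τ.toGNS '' (M : Set A)) := by
      rintro _ ⟨h, hh, rfl⟩
      exact ⟨h * s, M.mul_mem hh s.2, (hR h).symm⟩
    have := hmaps.closure R.continuous
    rw [← coe_hardySpace] at this
    exact this x.2
  exact ⟨(R ∘L (hardySpace τ M).subtypeL).codRestrict _ hmem, fun h => Subtype.ext (hR h)⟩

/-- Right multiplication by a unit `s` with `s, s⁻¹ ∈ M` is invertible on the Hardy space. -/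
theorem exists_isUnit_hardySpace_rightMul (hcomm : ∀ x y, τ (x * y) = τ (y * x)) {s : Aˣ}
    (hs : (s : A) ∈ M) (hs' : ((s⁻¹ : Aˣ) : A) ∈ M) :
    ∃ Z : hardySpace τ M →L[ℂ] hardySpace τ M, IsUnit Z ∧
      ∀ h : M, Z (toHardySpace τ M h) = toHardySpace τ M (h * ⟨s, hs⟩) := by
  obtain ⟨Z, hZ⟩ := exists_hardySpace_rightMul hcomm ⟨s, hs⟩
  obtain ⟨Z', hZ'⟩ := exists_hardySpace_rightMul hcomm ⟨_, hs'⟩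
  refine ⟨Z, ⟨⟨Z, Z', ?_, ?_⟩, rfl⟩, hZ⟩
  · refine hardySpace_operator_ext fun x y => ?_
    have : y * ⟨_, hs'⟩ * ⟨s, hs⟩ = y := Subtype.ext (by simp)
    rw [mul_apply_eq_comp, hZ', hZ, this, one_apply_eq_self]
  · refine hardySpace_operator_ext fun x y => ?_
    have : y * ⟨s, hs⟩ * ⟨_, hs'⟩ = y := Subtype.ext (by simp)
    rw [mul_apply_eq_comp, hZ, hZ', this, one_apply_eq_self]

end Factorization

/-- Invertible operators that implement maps agreeing with a unital one are unitarily related. -/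
theorem exists_unitary_of_star_mul_mul_eq {X : Type*} {B : Type*} [Monoid B] [StarMul B]
    {T Z : B} (hT : IsUnit T) (hZ : IsUnit Z) {f g : X → B} {x₀ : X} (hf : f x₀ = 1)
    (hg : g x₀ = 1) (h : ∀ x, star T * g x * T = star Z * f x * Z) :
    ∃ U ∈ unitary B, ∀ x, g x = star U * f x * U := by
  obtain ⟨T, rfl⟩ := hT
  obtain ⟨Z, rfl⟩ := hZ
  have hTZ : star T * T = star Z * Z := Units.ext (by simpa [hf, hg] using h x₀)
  have hU : star (Z * T⁻¹) * (Z * T⁻¹) = 1 := by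
    rw [star_mul, mul_assoc, ← mul_assoc (star Z), ← hTZ, star_inv]
    simp
  refine ⟨(Z * T⁻¹ : Bˣ), Unitary.mem_iff.mpr
    ⟨congrArg Units.val hU, congrArg Units.val (mul_eq_one_comm.mp hU)⟩, fun x => ?_⟩
  calc g x = ((star T)⁻¹ * star T : Bˣ) * g x * (T * T⁻¹ : Bˣ) := by simp
    _ = ((star T)⁻¹ : Bˣ) * (star (T : B) * g x * T) * (T⁻¹ : Bˣ) := by
        simp only [Units.val_mul, Units.coe_star, mul_assoc]
    _ = star ((Z * T⁻¹ : Bˣ) : B) * f x * (Z * T⁻¹ : Bˣ) := by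
        rw [h, ← Units.coe_star (Z * T⁻¹), star_mul, star_inv]
        simp only [Units.val_mul, Units.coe_star, mul_assoc]

theorem ContinuousLinearMap.exists_norm_sq_le_of_isUnit {E : Type*} [NormedAddCommGroup E]
    [NormedSpace ℂ E] {T : E →L[ℂ] E} (hT : IsUnit T) :
    ∃ c : ℝ, ∀ x, ‖x‖ ^ 2 ≤ c * ‖T x‖ ^ 2 := by
  obtain ⟨T, rfl⟩ := hT
  refine ⟨‖((T⁻¹ : (E →L[ℂ] E)ˣ) : E →L[ℂ] E)‖ ^ 2, fun x => ?_⟩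
  have hx : ((T⁻¹ : (E →L[ℂ] E)ˣ) : E →L[ℂ] E) ((T : E →L[ℂ] E) x) = x := by
    rw [← mul_apply_eq_comp, Units.inv_mul, one_apply_eq_self]
  rw [← mul_pow]
  refine pow_le_pow_left₀ (norm_nonneg _) ?_ 2
  nth_rewrite 1 [← hx]
  exact ContinuousLinearMap.le_opNorm _ _

/-! ### C⋆-extremality of the compression -/

section Hardy

variable {A : Type u} [CStarAlgebra A] [PartialOrder A] [StarOrderedRing A] {τ : A →ₚ[ℂ] ℂ}
  {M : NonUnitalSubalgebra ℂ A}

theorem inner_compression_toHardySpace (a : A) (h k : M) :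
    ⟪toHardySpace τ M h, compression τ.gnsStarAlgHom (hardySpace τ M) a (toHardySpace τ M k)⟫_ℂ =
      τ (star (h : A) * a * k) := by
  rw [inner_compression]
  change ⟪τ.toGNS h, τ.gnsStarAlgHom a (τ.toGNS k)⟫_ℂ = _
  rw [PositiveLinearMap.gnsStarAlgHom_toGNS, PositiveLinearMap.inner_toGNS, mul_assoc]

variable {n : ℕ} {T : Fin n → (hardySpace τ M →L[ℂ] hardySpace τ M)}
  {φs : Fin n → (A →ₗ[ℂ] (hardySpace τ M →L[ℂ] hardySpace τ M))}

/-- The sesquilinear forms of the summands of a `C⋆`-combination are determined by their values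
at the unit of `M`. -/
theorem inner_apply_toHardySpace (hM : HasFactorization M)
    (hφs : ∀ i, φs i ∈ generalizedStateSpace A (hardySpace τ M))
    (hsum : ∀ a, compression τ.gnsStarAlgHom (hardySpace τ M) a =
      ∑ i, star (T i) * φs i a * T i) (i : Fin n) (a : A) (h k : M) :
    ⟪T i (toHardySpace τ M h), φs i a (T i (toHardySpace τ M k))⟫_ℂ =
      ⟪T i (toHardySpace τ M ⟨1, hM.one_mem⟩),
        φs i (star (h : A) * a * k) (T i (toHardySpace τ M ⟨1, hM.one_mem⟩))⟫_ℂ := by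
  have hmove (b : A) (k : M) : φs i b (T i (toHardySpace τ M k)) =
      φs i (b * k) (T i (toHardySpace τ M ⟨1, hM.one_mem⟩)) := by
    refine apply_eq_apply_of_compression_eq_sum hφs hsum ?_ i
    change τ.gnsStarAlgHom b (τ.toGNS k) = τ.gnsStarAlgHom (b * k) (τ.toGNS 1)
    rw [PositiveLinearMap.gnsStarAlgHom_toGNS, PositiveLinearMap.gnsStarAlgHom_toGNS, mul_one]
  have hadj (b : A) (x y : hardySpace τ M) : ⟪x, φs i b y⟫_ℂ = ⟪φs i (star b) x, y⟫_ℂ := by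
    rw [generalizedStateSpace.map_star (hφs i), ContinuousLinearMap.star_eq_adjoint,
      ContinuousLinearMap.adjoint_inner_left]
  rw [hmove, hadj, hmove, hadj (star (h : A) * a * k)]
  simp only [star_mul, star_star, mul_assoc]

/-- The compression to the Hardy space is `C⋆`-extreme as soon as the functionals dominated by the
trace have densities. -/
theorem isCStarExtreme_compression_hardySpace (hcomm : ∀ x y, τ (x * y) = τ (y * x))
    (hfaith : ∀ x, τ (star x * x) = 0 → x = 0)
    (hdensity : ∀ ω : A →ₚ[ℂ] ℂ, (∀ x, 0 ≤ x → ω x ≤ τ x) → ∃ d : A, 0 ≤ d ∧ ∀ x, ω x = τ (x * d))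
    (hM : HasFactorization M) :
    IsCStarExtreme (compression τ.gnsStarAlgHom (hardySpace τ M)) := by
  have hφ := compression_mem_generalizedStateSpace τ.gnsStarAlgHom (hardySpace τ M)
  refine ⟨hφ, fun n T φs hφs hT _ hsum i => ?_⟩
  set e : hardySpace τ M := toHardySpace τ M ⟨1, hM.one_mem⟩ with he
  have hform := inner_apply_toHardySpace hM hφs hsum i
  obtain ⟨ω, hω⟩ := generalizedStateSpace.exists_vectorFunctional (hφs i) (T i e)
  have hωτ (x : A) (hx : 0 ≤ x) : ω x ≤ τ x := by
    have h1 : τ x = ∑ j, ⟪T j e, φs j x (T j e)⟫_ℂ := by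
      have h2 := inner_compression_toHardySpace (τ := τ) x ⟨1, hM.one_mem⟩ ⟨1, hM.one_mem⟩
      rw [star_one, one_mul, mul_one, ← he, hsum, _root_.sum_apply, inner_sum] at h2
      rw [← h2]
      refine Finset.sum_congr rfl fun j _ => ?_
      rw [mul_apply_eq_comp, mul_apply_eq_comp, ContinuousLinearMap.star_eq_adjoint,
        ContinuousLinearMap.adjoint_inner_right]
    rw [h1, hω]
    exact Finset.single_le_sum (f := fun j => ⟪T j e, φs j x (T j e)⟫_ℂ)
      (fun j _ => ((ContinuousLinearMap.nonneg_iff_isPositive _).mp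
        (generalizedStateSpace.map_nonneg (hφs j) hx)).inner_nonneg_right _) (Finset.mem_univ i)
  obtain ⟨d, hd0, hd⟩ := hdensity ω hωτ
  obtain ⟨c, hc⟩ := ContinuousLinearMap.exists_norm_sq_le_of_isUnit (hT i)
  have hdu : IsUnit d := by
    -- For x = s⋆s with s ∈ M, ω(x) = ‖Tᵢ[s]‖² and τ(x) = ‖[s]‖², so c comes from the lower bound on
    -- Tᵢ.
    refine isUnit_of_trace_le hcomm hfaith hd0 (c := c) fun x hx hxu => ?_
    obtain ⟨s, hs, -, rfl⟩ := hM x hx hxu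
    have h1 := hform 1 ⟨s, hs⟩ ⟨s, hs⟩
    rw [mul_one, ← he, ← hω, (hφs i).1, one_apply_eq_self] at h1
    have h2 : ω (star (s : A) * s) = ((‖T i (toHardySpace τ M ⟨s, hs⟩)‖ ^ 2 : ℝ) : ℂ) := by
      have h3 := inner_self_eq_norm_sq_to_K (𝕜 := ℂ) (T i (toHardySpace τ M ⟨s, hs⟩))
      refine h1.symm.trans (h3.trans ?_)
      simp
    rw [← hd, h2, ← PositiveLinearMap.norm_toGNS_sq, ← Complex.ofReal_mul]
    exact Complex.real_le_real.mpr (hc (toHardySpace τ M ⟨s, hs⟩))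
  -- The order s s⋆ matters: the trace moves s⋆ to the front, leaving right multiplication by s on
  -- both arguments.
  obtain ⟨s, hs, hs', rfl⟩ := hM.exists_mul_star hd0 hdu
  obtain ⟨Z, hZu, hZ⟩ := exists_isUnit_hardySpace_rightMul hcomm hs hs'
  refine exists_unitary_of_star_mul_mul_eq (hT i) hZu hφ.1 (hφs i).1 fun a => ?_
  refine hardySpace_operator_ext fun h k => ?_
  rw [mul_apply_eq_comp, mul_apply_eq_comp, mul_apply_eq_comp, mul_apply_eq_comp,
    ContinuousLinearMap.star_eq_adjoint, ContinuousLinearMap.star_eq_adjoint,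
    ContinuousLinearMap.adjoint_inner_right, ContinuousLinearMap.adjoint_inner_right, hform, ← he,
    ← hω, hd, hZ, hZ, inner_compression_toHardySpace]
  change _ = τ (star ((h : A) * s) * a * (k * s))
  rw [← mul_assoc, hcomm, star_mul]
  simp only [mul_assoc]

end Hardy

end

theorem mainTheorem12 {K : Type*} [NormedAddCommGroup K] [InnerProductSpace ℂ K] [CompleteSpace K]
    (A : VonNeumannAlgebra K) (τ : A →ₚ[ℂ] ℂ) (hτ : A.IsFaithfulNormalTrace τ)
    (M : NonUnitalSubalgebra ℂ A) (hM : HasFactorization M) :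
    IsCStarExtreme (compression τ.gnsStarAlgHom (hardySpace τ M)) :=
  isCStarExtreme_compression_hardySpace hτ.map_mul_comm hτ.faithful
    (fun _ hω => hτ.exists_density hω) hM
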